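/- Setting. There are $N_1$ treated units $j=1,\dots,N_1$ and an infinite sequence of never-treated (control) units $i=N_1+1,N_1+2,\dots$; the sample with $N_0$ controls consists of the units $1,\dots,N=N_1+N_0$, observed in periods $t=1,\dots,T$. Potential outcomes are $y_{i,t}(0)=\theta_i+\gamma_t+\eta_{i,t}$ and $y_{i,t}(1)=\alpha_{i,t}+y_{i,t}(0)$, with $\theta_i,\gamma_t$ unrestricted and $\alpha_{i,t}$ nonrandom. With $t^*_j\in\{1,\dots,T-1\}$ for $j\le N_1$ and $t^*_i=\infty$ for controls, the observed outcome is $y_{i,t}=y_{i,t}(1)$ if $t>t_i^*$ and $y_{i,t}=y_{i,t}(0)$ otherwise. Write $\boldsymbol Y_i=(y_{i,1},\dots,y_{i,T})'$ and $\boldsymbol\eta_i=(\eta_{i,1},\dots,\eta_{i,T})'$. Covariates $Z_i$ are nonrandom. For $j\le N_1$, $A_j$ and $B_j$ are fixed real matrices of sizes $K_j\times T$ and $K\times K_j$. $\lVert\cdot\rVert$ is the spectral norm, $\lambda_{\min}$ the smallest eigenvalue, and $\le$ between vectors is coordinatewise. Assume: 1. (Sampling) the random vectors $\boldsymbol\eta_i$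 are mutually independent with finite second moments. 2. (Parallel trends) for each $j\le N_1$ and each control $i$, $B_jA_j\mathbb E[\boldsymbol\eta_j]=B_jA_j\mathbb E[\boldsymbol\eta_i]$, and each row of $B_jA_j$ sums to zero. 3. (Parametric heteroskedasticity) for each $j\le N_1$ and every $i\in\{j\}\cup\{N_1+1,N_1+2,\dots\}$, $B_jA_j\boldsymbol\eta_i=H_j(Z_i;\delta_j)\,\xi_{i,j}$ almost surely, where $\delta_j\in\Delta_j\subseteq\mathbb R^{p_j}$, $H_j(\cdot;\cdot)$ is a function with values in the $K\times K$ real matrices, $H_j(Z_i;\delta_j)$ is (symmetric) positive definite, the $\xi_{i,j}$ have the same distribution for all these $i$, $\mathbb E[\xi_{j,j}]=0$, and $\xi_{j,j}$ has a continuous distribution in the sense that $\mathbb P[a'\xi_{j,j}=b]=0$ for all $a\in\mathbb R^K\setminus\{0\}$ and $b\in\mathbb R$ (as holds whenever $\xi_{j,j}$ has a Lebesgue density; for $K=1$ this is continuity of the distribution function). 4. The estimators $\hat\delta_j\in\Delta_j$, which depend on $N_0$, satisfy for each $j\le N_1$, as $N_0\to\infty$, $\max_{i\in\{j\}\cup\{N_1+1,\dots,N\}}\lVert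 H_j(Z_i;\hat\delta_j)-H_j(Z_i;\delta_j)\rVert\overset{p}{\to}0$. 5. There are $0<\underline h\le\overline h<\infty$ such that, for all $j\le N_1$, $\lambda_{\min}(H_j(Z_i;\delta_j))\ge\underline h$ for all controls $i$ and $\lVert H_j(Z_i;\delta_j)\rVert\le\overline h$ for $i=j$ and all controls $i$. For controls $i\le N$ let $\widehat W_i(j)=B_jA_j\boldsymbol Y_i-\frac1{N_0}\sum_{i'=N_1+1}^N B_jA_j\boldsymbol Y_{i'}$ and $\widetilde W_i(j)=H_j(Z_i;\hat\delta_j)^{-1}\widehat W_i(j)$ (with the inverse of a singular matrix read as $0$), and let $$\hat F(c)=\frac1{N_0^{N_1}}\sum_{i_1=N_1+1}^N\cdots\sum_{i_{N_1}=N_1+1}^N\mathbf 1\Big\{\sum_{j=1}^{N_1}H_j(Z_j;\hat\delta_j)\,\widetilde W_{i_j}(j)\le c\Big\},\qquad c\in\mathbb R^K.$$ Let $F$ be the distribution function of $\sum_{j=1}^{N_1}B_jA_j\boldsymbol\eta_j$. Then, with $N_1$ fixed and $N_0\to\infty$, $$\sup_{c\in\mathbb R^K}\bigl|\hat F(c)-F(c)\bigr|\overset{p}{\to}0.$$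 -/

import Mathlib

open MeasureTheory ProbabilityTheory Filter Topology
open scoped Matrix

noncomputable section

namespace FewTreatedDID

/-- The units: `Sum.inl j` is the treated unit `j`, and `Sum.inr i` is the `i`-th never-treated
(control) unit. The sample with `n` controls consists of all treated units and of the controls
`Sum.inr 0, …, Sum.inr (n - 1)`. -/
abbrev Units (N₁ : ℕ) : Type := Fin N₁ ⊕ ℕ

/-- The last period before treatment: `tStar j` for the treated unit `j`, and `∞` for controls. -/
def lastUntreated {N₁ : ℕ} (tStar : Fin N₁ → ℕ) : Units N₁ → ℕ∞ :=
  Sum.elim (fun j => (tStar j : ℕ∞)) (fun _ => ⊤)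

/-- Untreated potential outcome `y_{i,t}(0) = θ_i + γ_t + η_{i,t}`. The index `t : Fin T` stands
for the period `t + 1` of `{1, …, T}`. The effects `θ`, `γ` may be random, without restriction. -/
def outcomeUntreated {N₁ T : ℕ} {Ω : Type*} (θ : Units N₁ → Ω → ℝ) (γ : Fin T → Ω → ℝ)
    (η : Units N₁ → Ω → Fin T → ℝ) (i : Units N₁) (t : Fin T) (ω : Ω) : ℝ :=
  θ i ω + γ t ω + η i ω t

/-- Treated potential outcome `y_{i,t}(1) = α_{i,t} + y_{i,t}(0)`, with nonrandom effects `α`. -/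
def outcomeTreated {N₁ T : ℕ} {Ω : Type*} (α : Units N₁ → Fin T → ℝ)
    (θ : Units N₁ → Ω → ℝ) (γ : Fin T → Ω → ℝ)
    (η : Units N₁ → Ω → Fin T → ℝ) (i : Units N₁) (t : Fin T) (ω : Ω) : ℝ :=
  α i t + outcomeUntreated θ γ η i t ω

/-- The vector `Y_i = (y_{i,1}, …, y_{i,T})` of observed outcomes: the treated potential outcome
in the periods after the last untreated one, the untreated potential outcome up to it. -/
def observedOutcome {N₁ T : ℕ} {Ω : Type*} (tStar : Fin N₁ → ℕ) (α : Units N₁ → Fin T → ℝ)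
    (θ : Units N₁ → Ω → ℝ) (γ : Fin T → Ω → ℝ)
    (η : Units N₁ → Ω → Fin T → ℝ) (i : Units N₁) (ω : Ω) : Fin T → ℝ := fun t =>
  if lastUntreated tStar i < (((t : ℕ) + 1 : ℕ) : ℕ∞) then outcomeTreated α θ γ η i t ω
  else outcomeUntreated θ γ η i t ω

/-- Sampling: the error vectors `η_i` are random vectors that are mutually independent across
units, with finite second moments. -/
structure Sampling {N₁ T : ℕ} {Ω : Type*} [MeasurableSpace Ω] (P : Measure Ω)
    (η : Units N₁ → Ω → Fin T → ℝ) : Prop where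
  measurable : ∀ i, Measurable (η i)
  indep : iIndepFun η P
  second_moment : ∀ i t, MemLp (fun ω => η i ω t) 2 P

/-- Parallel trends: `B_j A_j E[η_j] = B_j A_j E[η_i]` for each treated unit `j` and each control
`i`, and each row of `B_j A_j` sums to zero. -/
structure ParallelTrends {N₁ T K : ℕ} {Kb : Fin N₁ → ℕ} {Ω : Type*} [MeasurableSpace Ω]
    (P : Measure Ω) (A : (j : Fin N₁) → Matrix (Fin (Kb j)) (Fin T) ℝ)
    (B : (j : Fin N₁) → Matrix (Fin K) (Fin (Kb j)) ℝ)
    (η : Units N₁ → Ω → Fin T → ℝ) : Prop where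
  mean_eq : ∀ (j : Fin N₁) (i : ℕ),
    (B j * A j) *ᵥ (fun t => ∫ ω, η (Sum.inl j) ω t ∂P)
      = (B j * A j) *ᵥ (fun t => ∫ ω, η (Sum.inr i) ω t ∂P)
  row_sum : ∀ (j : Fin N₁) (k : Fin K), ∑ t, (B j * A j) k t = 0

/-- `i` is the treated unit `j` itself or a control. -/
def IsComparison {N₁ : ℕ} (j : Fin N₁) (i : Units N₁) : Prop :=
  i = Sum.inl j ∨ ∃ m : ℕ, i = Sum.inr m

/-- The treated unit `j` together with the first `n` controls. -/
def comparisonUnits {N₁ : ℕ} (j : Fin N₁) (n : ℕ) : Finset (Units N₁) :=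
  insert (Sum.inl j) ((Finset.range n).image Sum.inr)

theorem comparisonUnits_nonempty {N₁ : ℕ} (j : Fin N₁) (n : ℕ) :
    (comparisonUnits j n).Nonempty :=
  Finset.insert_nonempty _ _

/-- A random vector in `ℝ^K` has a continuous distribution when all its nontrivial linear
combinations are atomless, that is, when it lies in any given affine hyperplane with probability
zero. Every distribution with a Lebesgue density has this property, and for `K = 1` it says that
the distribution function is continuous. -/
def ContinuousDistribution {K : ℕ} {Ω : Type*} [MeasurableSpace Ω] (P : Measure Ω)
    (X : Ω → Fin K → ℝ) : Prop :=
  ∀ (a : Fin K → ℝ) (b : ℝ), a ≠ 0 → P {ω | a ⬝ᵥ X ω = b} = 0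

/-- The parametric model of heteroskedasticity: `B_j A_j η_i = H_j(Z_i; δ_j) ξ_{i,j}` for `i`
equal to `j` or a control, with positive definite `H_j(Z_i; δ_j)`, with `ξ_{i,j}` identically
distributed over these `i`, and with `ξ_{j,j}` of mean zero and continuously distributed. -/
structure ParametricModel {N₁ T K : ℕ} {Kb : Fin N₁ → ℕ} {Ω 𝒵 : Type*} [MeasurableSpace Ω]
    (P : Measure Ω) (A : (j : Fin N₁) → Matrix (Fin (Kb j)) (Fin T) ℝ)
    (B : (j : Fin N₁) → Matrix (Fin K) (Fin (Kb j)) ℝ)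
    (η : Units N₁ → Ω → Fin T → ℝ) (Z : Units N₁ → 𝒵)
    {p : Fin N₁ → ℕ} {Δ : (j : Fin N₁) → Set (Fin (p j) → ℝ)}
    (H : (j : Fin N₁) → 𝒵 → Δ j → Matrix (Fin K) (Fin K) ℝ) (δ : (j : Fin N₁) → Δ j)
    (ξ : Units N₁ → Fin N₁ → Ω → Fin K → ℝ) : Prop where
  factor : ∀ (j : Fin N₁) (i : Units N₁), IsComparison j i →
    ∀ᵐ ω ∂P, (B j * A j) *ᵥ η i ω = H j (Z i) (δ j) *ᵥ ξ i j ω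
  posDef : ∀ (j : Fin N₁) (i : Units N₁), IsComparison j i → (H j (Z i) (δ j)).PosDef
  identDistrib : ∀ (j : Fin N₁) (i i' : Units N₁), IsComparison j i → IsComparison j i' →
    IdentDistrib (ξ i j) (ξ i' j) P P
  continuous : ∀ j : Fin N₁, ContinuousDistribution P (ξ (Sum.inl j) j)
  mean_zero : ∀ (j : Fin N₁) (k : Fin K),
    Integrable (fun ω => ξ (Sum.inl j) j ω k) P ∧ ∫ ω, ξ (Sum.inl j) j ω k ∂P = 0

/-- The spectral norm of a square real matrix: the operator norm for the Euclidean norm. -/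
def specNorm {K : ℕ} (M : Matrix (Fin K) (Fin K) ℝ) : ℝ :=
  ‖Matrix.toEuclideanCLM (n := Fin K) (𝕜 := ℝ) M‖

/-- `Ŵ_i(j) = B_j A_j Y_i - (1/n) ∑_{i'} B_j A_j Y_{i'}`, the sum running over the `n` controls,
where `Y i` is the observed outcome vector of unit `i`; here `i` is (the number of) a control. -/
def residual {N₁ T K : ℕ} {Kb : Fin N₁ → ℕ}
    (A : (j : Fin N₁) → Matrix (Fin (Kb j)) (Fin T) ℝ)
    (B : (j : Fin N₁) → Matrix (Fin K) (Fin (Kb j)) ℝ)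
    (Y : Units N₁ → Fin T → ℝ) (n : ℕ) (j : Fin N₁) (i : ℕ) : Fin K → ℝ :=
  (B j * A j) *ᵥ Y (Sum.inr i)
    - (1 / (n : ℝ)) • ∑ i' ∈ Finset.range n, (B j * A j) *ᵥ Y (Sum.inr i')

/-- `W̃_i(j) = H_j(Z_i; d_j)⁻¹ Ŵ_i(j)`, where `d` is the estimate of `δ`. (By Mathlib's convention
the inverse of a singular matrix is the zero matrix.) -/
def scaledResidual {N₁ T K : ℕ} {Kb : Fin N₁ → ℕ} {𝒵 : Type*}
    (A : (j : Fin N₁) → Matrix (Fin (Kb j)) (Fin T) ℝ)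
    (B : (j : Fin N₁) → Matrix (Fin K) (Fin (Kb j)) ℝ)
    (Y : Units N₁ → Fin T → ℝ) (Z : Units N₁ → 𝒵)
    {p : Fin N₁ → ℕ} {Δ : (j : Fin N₁) → Set (Fin (p j) → ℝ)}
    (H : (j : Fin N₁) → 𝒵 → Δ j → Matrix (Fin K) (Fin K) ℝ) (d : (j : Fin N₁) → Δ j)
    (n : ℕ) (j : Fin N₁) (i : ℕ) : Fin K → ℝ :=
  (H j (Z (Sum.inr i)) (d j))⁻¹ *ᵥ residual A B Y n j i

open Classical in
/-- The bootstrap distribution function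
`F̂(c) = n^{-N₁} ∑_{i_1} ⋯ ∑_{i_{N₁}} 1{∑_j H_j(Z_j; d_j) W̃_{i_j}(j) ≤ c}`: the sums run over the
`n` controls, and `≤` holds coordinate by coordinate. -/
def bootstrapCDF {N₁ T K : ℕ} {Kb : Fin N₁ → ℕ} {𝒵 : Type*}
    (A : (j : Fin N₁) → Matrix (Fin (Kb j)) (Fin T) ℝ)
    (B : (j : Fin N₁) → Matrix (Fin K) (Fin (Kb j)) ℝ)
    (Y : Units N₁ → Fin T → ℝ) (Z : Units N₁ → 𝒵)
    {p : Fin N₁ → ℕ} {Δ : (j : Fin N₁) → Set (Fin (p j) → ℝ)}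
    (H : (j : Fin N₁) → 𝒵 → Δ j → Matrix (Fin K) (Fin K) ℝ) (d : (j : Fin N₁) → Δ j)
    (n : ℕ) (c : Fin K → ℝ) : ℝ :=
  (1 / (n : ℝ) ^ N₁) * ∑ s : Fin N₁ → Fin n,
    if ∑ j, H j (Z (Sum.inl j)) (d j) *ᵥ scaledResidual A B Y Z H d n j (s j) ≤ c
      then (1 : ℝ) else 0

/-- `F(c)`, the distribution function of `∑_j B_j A_j η_j`, the sum over the treated units. -/
def targetCDF {N₁ T K : ℕ} {Kb : Fin N₁ → ℕ} {Ω : Type*} [MeasurableSpace Ω] (P : Measure Ω)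
    (A : (j : Fin N₁) → Matrix (Fin (Kb j)) (Fin T) ℝ)
    (B : (j : Fin N₁) → Matrix (Fin K) (Fin (Kb j)) ℝ)
    (η : Units N₁ → Ω → Fin T → ℝ) (c : Fin K → ℝ) : ℝ :=
  P.real {ω | ∑ j, (B j * A j) *ᵥ η (Sum.inl j) ω ≤ c}

end FewTreatedDID

end

/-!
The convergence is uniform because the limit `F` has no atoms in any coordinate, as soon as there
is a treated unit (otherwise both distribution functions are that of the zero vector): by Pólya's theorem
(`eventually_forall_abs_measureReal_Iic_sub_le`) it suffices that the bootstrap distribution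
converges weakly, in probability, to the law of `∑ j, B j A j η j`. Here closeness in the
Lévy–Prokhorov metric is turned into uniform closeness of distribution functions.

The bootstrap distribution is the law of a sum of independent draws from `N₁` empirical measures,
one for each treated unit (`bootstrapCDF_eq_measureReal`). Products and continuous images of
probability measures are weakly continuous, so each empirical measure may be treated separately.
For the treated unit `j`, write `B j A j η i = H i ζ i` with `ζ i` independent and identically
distributed over controls and distributed as `ζ j`. If the scale matrices and the mean of the
controls were known, the rescaled residuals would be `H j ζ i`, whose empirical measures converge by
the law of large numbers to the law of `H j ζ j = B j A j η j` (`tendsto_empirical_inProb`). The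
actual residuals differ from these by at most a constant times `e ‖ζ i‖ + ‖m‖`, where `e` is the
uniform estimation error and `m` the mean of the `H i ζ i` (`euclNorm_rescale_sub_le`). The average
of this bound tends to zero, since `e → 0` by assumption, the average of `‖ζ i‖` converges, and
`m → 0` by Chebyshev's inequality. Points that are close on average have close empirical measures
(`tendsto_empirical_of_tendsto_dist`).

The estimators are not assumed measurable, so almost sure convergence along subsequences is not
available as a tool. Convergence in probability is instead expressed as convergence along a filter
on `ℕ × Ω` (`inProb`); this applies to values in the space of probability measures, and all
continuity arguments become ordinary statements on limits.
-/

namespace FewTreatedDID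

/-! ### Convergence in probability as convergence along a filter -/

section InProb

variable {Ω : Type*} [MeasurableSpace Ω]

/-- The filter of the sets `S ⊆ ℕ × Ω` whose sections `{ω | (n, ω) ∈ S}` hold with (outer)
probability tending to one as `n → ∞`. Limits along it are limits in probability, without any
measurability requirement, and for values in an arbitrary topological space. -/
def inProb (P : Measure Ω) : Filter (ℕ × Ω) where
  sets := {S | Tendsto (fun n => P {ω | (n, ω) ∉ S}) atTop (𝓝 0)}
  univ_sets := by simp
  sets_of_superset {S U} hS hSU := tendsto_of_tendsto_of_tendsto_of_le_of_le tendsto_const_nhds hS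
    (fun _ => zero_le) fun n => measure_mono fun _ h h' => h (hSU h')
  inter_sets {S U} hS hU := by
    have h := Tendsto.add hS hU
    rw [add_zero] at h
    refine tendsto_of_tendsto_of_tendsto_of_le_of_le tendsto_const_nhds h (fun _ => zero_le)
      fun n => (measure_mono ?_).trans (measure_union_le _ _)
    intro ω hω
    by_cases h1 : (n, ω) ∈ S
    · exact Or.inr fun h2 => hω ⟨h1, h2⟩
    · exact Or.inl h1

theorem mem_inProb {P : Measure Ω} {S : Set (ℕ × Ω)} :
    S ∈ inProb P ↔ Tendsto (fun n => P {ω | (n, ω) ∉ S}) atTop (𝓝 0) := Iff.rfl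

theorem tendstoInMeasure_const_iff_tendsto_inProb {E : Type*} [PseudoMetricSpace E] {P : Measure Ω}
    {f : ℕ → Ω → E} {a : E} :
    TendstoInMeasure P f atTop (fun _ => a) ↔
      Tendsto (fun x : ℕ × Ω => f x.1 x.2) (inProb P) (𝓝 a) := by
  rw [tendstoInMeasure_iff_dist, Metric.tendsto_nhds]
  refine forall₂_congr fun ε hε => ?_
  simp [Filter.Eventually, mem_inProb]

theorem tendsto_fst_inProb (P : Measure Ω) : Tendsto Prod.fst (inProb P) atTop := by
  rw [tendsto_atTop]
  intro N
  refine mem_inProb.2 (tendsto_const_nhds.congr' ?_)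
  filter_upwards [eventually_ge_atTop N] with n hn
  simp [hn]

end InProb

/-! ### Empirical measures -/

section Empirical

variable {E : Type*} [MeasurableSpace E]

/-- The empirical measure of the points `v 0, …, v (n - 1)`; for `n = 0`, a Dirac measure, so that
it always is a probability measure. -/
noncomputable def empirical (n : ℕ) (v : ℕ → E) : ProbabilityMeasure E :=
  ⟨((Fintype.card (Fin (n - 1 + 1)) : ENNReal)⁻¹ •
      (Measure.count : Measure (Fin (n - 1 + 1)))).map (fun i : Fin _ => v i), by
    refine @Measure.isProbabilityMeasure_map _ _ _ _ _ ⟨?_⟩ _ (by fun_prop)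
    simp [ENNReal.inv_mul_cancel]⟩

theorem coe_empirical {n : ℕ} (hn : n ≠ 0) (v : ℕ → E) :
    (empirical n v : Measure E) =
      ((n : ENNReal)⁻¹ • (Measure.count : Measure (Fin n))).map (fun i : Fin n => v i) := by
  obtain ⟨m, rfl⟩ := Nat.exists_eq_succ_of_ne_zero hn
  simp only [empirical, ProbabilityMeasure.coe_mk, Fintype.card_fin]
  rfl

theorem integral_empirical {n : ℕ} (hn : n ≠ 0) (v : ℕ → E) {f : E → ℝ} (hf : Measurable f) :
    ∫ x, f x ∂(empirical n v : Measure E) = (∑ i ∈ Finset.range n, f (v i)) / n := by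
  rw [coe_empirical hn, integral_map (by fun_prop) hf.aestronglyMeasurable, integral_smul_measure,
    integral_count, Finset.sum_range]
  simp [div_eq_inv_mul]

theorem measure_empirical {n : ℕ} (hn : n ≠ 0) (v : ℕ → E) {s : Set E} (hs : MeasurableSet s) :
    (empirical n v : Measure E) s = (n : ENNReal)⁻¹ * Measure.count {i : Fin n | v i ∈ s} := by
  rw [coe_empirical hn, Measure.map_apply (by fun_prop) hs]
  rfl

/-- The sum of independent draws from the empirical measures of `v 0, v 1, …` is the average over
all multi-indices. -/
theorem measureReal_map_sum_pi_empirical {ι : Type*} [Fintype ι] [DecidableEq ι]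
    [AddCommMonoid E]
    [MeasurableAdd₂ E] {n : ℕ} (hn : n ≠ 0) (v : ι → ℕ → E) {s : Set E} (hs : MeasurableSet s)
    [∀ x, Decidable (x ∈ s)] :
    ((Measure.pi fun j => (empirical n (v j) : Measure E)).map fun x => ∑ j, x j).real s =
      1 / (n : ℝ) ^ Fintype.card ι *
        ∑ i : ι → Fin n, if ∑ j, v j (i j) ∈ s then (1 : ℝ) else 0 := by
  classical
  have hfin : IsFiniteMeasure ((n : ENNReal)⁻¹ • (Measure.count : Measure (Fin n))) :=
    ⟨by simp [ENNReal.mul_lt_top_iff, Nat.pos_of_ne_zero hn]⟩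
  have hms : Measurable fun x : ι → E => ∑ j, x j := by fun_prop
  simp_rw [coe_empirical hn]
  rw [← Measure.pi_map_pi (fun j => by fun_prop), Measure.map_map hms (by fun_prop),
    measureReal_def, Measure.map_apply (by fun_prop) hs]
  have hset : ((fun x : ι → E => ∑ j, x j) ∘ fun (i : ι → Fin n) j => v j (i j)) ⁻¹' s =
      ((Finset.univ.filter fun i : ι → Fin n => ∑ j, v j (i j) ∈ s : Finset _) :
        Set (ι → Fin n)) := by
    ext; simp
  rw [hset, ← sum_measure_singleton]
  have h1 (i : ι → Fin n) : (Measure.pi fun _ : ι =>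
      ((n : ENNReal)⁻¹ • (Measure.count : Measure (Fin n)))) {i} =
        (n : ENNReal)⁻¹ ^ Fintype.card ι := by
    rw [Measure.pi_singleton]; simp
  simp [h1, ENNReal.toReal_inv, mul_comm]

end Empirical

/-! ### Perturbation of empirical measures -/

/-- Points that are close on average have close empirical measures in the Lévy–Prokhorov
distance, since by Markov's inequality only few of them are far apart. -/
theorem levyProkhorovEDist_empirical_le {E : Type*} [MeasurableSpace E] [PseudoMetricSpace E]
    [OpensMeasurableSpace E] {n : ℕ} (hn : n ≠ 0) (u v : ℕ → E) {κ : ℝ} (hκ : 0 < κ)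
    (h : (∑ i ∈ Finset.range n, dist (u i) (v i)) / n ≤ κ ^ 2) :
    levyProkhorovEDist (empirical n u : Measure E) (empirical n v) ≤ ENNReal.ofReal κ := by
  have hn' : (0 : ℝ) < n := by positivity
  have hfar : (n : ENNReal)⁻¹ * Measure.count {i : Fin n | κ ≤ dist (u i) (v i)} ≤
      ENNReal.ofReal κ := by
    classical
    have hcard : (((Finset.univ.filter fun i : Fin n => κ ≤ dist (u i) (v i)).card : ℕ) : ℝ) * κ ≤
        κ ^ 2 * n := by
      rw [div_le_iff₀ hn', Finset.sum_range] at h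
      refine le_trans ?_ h
      rw [← nsmul_eq_mul]
      refine (Finset.card_nsmul_le_sum _ _ _ fun i hi => (Finset.mem_filter.1 hi).2).trans
        (Finset.sum_le_sum_of_subset_of_nonneg (Finset.filter_subset _ _)
          fun i _ _ => dist_nonneg)
    have hcard' : (((Finset.univ.filter fun i : Fin n => κ ≤ dist (u i) (v i)).card : ℕ) : ℝ) ≤
        κ * n := by nlinarith
    have hc : (Measure.count {i : Fin n | κ ≤ dist (u i) (v i)} : ENNReal) =
        ENNReal.ofReal ((Finset.univ.filter fun i : Fin n => κ ≤ dist (u i) (v i)).card : ℕ) := by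
      rw [ENNReal.ofReal_natCast, ← Measure.count_apply_finset]
      simp
    rw [hc, mul_comm, ← div_eq_mul_inv]
    refine ENNReal.div_le_of_le_mul ?_
    rw [← ENNReal.ofReal_natCast n, ← ENNReal.ofReal_mul hκ.le]
    exact ENNReal.ofReal_le_ofReal hcard'
  refine levyProkhorovEDist_le_of_forall _ _ _ fun ε B hε hε' hB => ?_
  have hκε : κ ≤ ε.toReal := by
    rw [← ENNReal.toReal_ofReal hκ.le]
    exact ENNReal.toReal_mono hε'.ne hε.le
  have key (u v : ℕ → E) (hfar : (n : ENNReal)⁻¹ *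
      Measure.count {i : Fin n | κ ≤ dist (u i) (v i)} ≤ ENNReal.ofReal κ) :
      (empirical n u : Measure E) B ≤
        (empirical n v : Measure E) (Metric.thickening ε.toReal B) + ε := by
    rw [measure_empirical hn u hB, measure_empirical hn v Metric.isOpen_thickening.measurableSet]
    refine le_trans ?_ (add_le_add_right (hfar.trans hε.le) _)
    rw [← mul_add]
    gcongr
    refine (measure_mono ?_).trans (measure_union_le _ _)
    intro i hi
    by_cases hd : κ ≤ dist (u i) (v i)
    · exact Or.inr hd
    · refine Or.inl (Metric.mem_thickening_iff.2 ⟨u i, hi, ?_⟩)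
      rw [dist_comm]
      exact (not_le.1 hd).trans_le hκε
  exact ⟨key u v hfar, key v u (by simpa only [dist_comm] using hfar)⟩

theorem tendsto_empirical_of_tendsto_dist {ι E : Type*} [MeasurableSpace E] [PseudoMetricSpace E]
    [TopologicalSpace.SeparableSpace E] [OpensMeasurableSpace E] {l : Filter ι} {n : ι → ℕ}
    {u v : ι → ℕ → E} {Q : ProbabilityMeasure E} (hn : ∀ᶠ x in l, n x ≠ 0)
    (hu : Tendsto (fun x => empirical (n x) (u x)) l (𝓝 Q))
    (huv : Tendsto (fun x => (∑ i ∈ Finset.range (n x), dist (v x i) (u x i)) / n x) l (𝓝 0)) :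
    Tendsto (fun x => empirical (n x) (v x)) l (𝓝 Q) := by
  rw [LevyProkhorov.probabilityMeasureHomeomorph.isInducing.tendsto_nhds_iff] at hu ⊢
  refine tendsto_of_tendsto_of_dist hu ?_
  rw [Metric.tendsto_nhds]
  intro ε hε
  filter_upwards [hn, huv.eventually_le_const (show (0 : ℝ) < (ε / 2) ^ 2 by positivity)]
    with x hx hd
  have := levyProkhorovEDist_empirical_le hx (v x) (u x) (half_pos hε) hd
  rw [Real.dist_0_eq_abs, abs_of_nonneg dist_nonneg, dist_comm]
  refine lt_of_le_of_lt ?_ (half_lt_self hε)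
  exact ENNReal.toReal_le_of_le_ofReal (by positivity) this

/-! ### Uniform convergence of distribution functions -/

/-- A finite measure without atoms gives uniformly little mass to small balls: the square of the
mass of a ball is the mass, under the product measure, of a subset of a neighbourhood of the
diagonal, and the diagonal is a null set. -/
theorem exists_forall_measure_closedBall_le {E : Type*} [MeasurableSpace E] [MetricSpace E]
    [SecondCountableTopology E] [OpensMeasurableSpace E] (μ : Measure E) [IsFiniteMeasure μ]
    [NullSingletonClass μ] {ε : ENNReal} (hε : ε ≠ 0) :
    ∃ κ > 0, ∀ b, μ (Metric.closedBall b κ) ≤ ε := by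
  let D : ℕ → Set (E × E) := fun n => {p | dist p.1 p.2 ≤ 1 / ((n : ℝ) + 1)}
  have hDm (n) : MeasurableSet (D n) := measurableSet_le (by fun_prop) measurable_const
  have hD : Tendsto (μ.prod μ ∘ D) atTop (𝓝 (μ.prod μ (⋂ n, D n))) := by
    refine tendsto_measure_iInter_atTop (fun n => (hDm n).nullMeasurableSet) ?_
      ⟨0, measure_ne_top _ _⟩
    intro m n hmn p hp
    have hmn' : (m : ℝ) ≤ n := by exact_mod_cast hmn
    have h : 1 / ((n : ℝ) + 1) ≤ 1 / ((m : ℝ) + 1) := by gcongr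
    exact le_trans (show dist p.1 p.2 ≤ _ from hp) h
  have hdiag : μ.prod μ (⋂ n, D n) = 0 := by
    rw [Measure.measure_prod_null (MeasurableSet.iInter hDm)]
    refine Eventually.of_forall fun x => ?_
    refine measure_mono_null (t := {x}) ?_ (measure_singleton x)
    intro y hy
    rw [Set.mem_preimage, Set.mem_iInter] at hy
    have : dist x y ≤ 0 :=
      ge_of_tendsto' tendsto_one_div_add_atTop_nhds_zero_nat fun n => hy n
    exact (dist_le_zero.1 this).symm
  rw [hdiag] at hD
  have hε2 : 0 < ε ^ 2 := ENNReal.pow_pos (pos_iff_ne_zero.2 hε) 2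
  obtain ⟨n, hn⟩ := (hD.eventually_lt_const hε2).exists
  refine ⟨1 / ((n : ℝ) + 1) / 2, by positivity, fun b => ?_⟩
  by_contra! hlt
  refine absurd hn (not_lt.2 ?_)
  calc ε ^ 2 ≤ μ (Metric.closedBall b (1 / ((n : ℝ) + 1) / 2)) ^ 2 := by gcongr
    _ = μ.prod μ (Metric.closedBall b _ ×ˢ Metric.closedBall b _) := by
      rw [Measure.prod_prod, sq]
    _ ≤ _ := measure_mono fun p hp => by
      have := dist_triangle_right p.1 p.2 b
      have h1 := Metric.mem_closedBall.1 hp.1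
      have h2 := Metric.mem_closedBall.1 hp.2
      change dist p.1 p.2 ≤ _
      linarith

/-- **Pólya's theorem** in `ℝ^K`: near a probability measure whose coordinates have no atoms, weak
closeness forces uniform closeness of the distribution functions. -/
theorem eventually_forall_abs_measureReal_Iic_sub_le {ι : Type*} [Fintype ι]
    (Q : ProbabilityMeasure (ι → ℝ)) (hQ : ∀ k b, (Q : Measure (ι → ℝ)) {x | x k = b} = 0)
    {ε : ℝ} (hε : 0 < ε) :
    ∀ᶠ R : ProbabilityMeasure (ι → ℝ) in 𝓝 Q, ∀ c,
      |(R : Measure (ι → ℝ)).real (Set.Iic c) - (Q : Measure (ι → ℝ)).real (Set.Iic c)| ≤ ε := by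
  have hna (k : ι) : NullSingletonClass ((Q : Measure (ι → ℝ)).map fun x => x k) :=
    ⟨fun b => by rw [Measure.map_apply (by fun_prop) (measurableSet_singleton b)]; exact hQ k b⟩
  set a : ℝ := ε / (2 * (Fintype.card ι + 1)) with ha_def
  have ha : 0 < a := by positivity
  choose κ hκ hκa using fun k => exists_forall_measure_closedBall_le
    ((Q : Measure (ι → ℝ)).map fun x => x k) (ENNReal.ofReal_pos.2 ha).ne'
  obtain ⟨r, hr, hrε, hrκ⟩ : ∃ r > 0, r ≤ ε / 2 ∧ ∀ k, r ≤ κ k := by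
    have h : ∀ᶠ r : ℝ in 𝓝[>] 0, r ≤ ε / 2 ∧ ∀ k, r ≤ κ k := by
      refine ((eventually_le_nhds (half_pos hε)).and ?_).filter_mono nhdsWithin_le_nhds
      exact eventually_all.2 fun k => eventually_le_nhds (hκ k)
    exact (h.and self_mem_nhdsWithin).exists.imp fun r hr => ⟨hr.2, hr.1⟩
  -- moving the corner by `r` changes the distribution function of `Q` by at most `ε / 2`
  have hslab (c c' : ι → ℝ) (hcc : ∀ k, c' k ≤ c k + r) :
      (Q : Measure (ι → ℝ)).real (Set.Iic c') ≤
        (Q : Measure (ι → ℝ)).real (Set.Iic c) + ε / 2 := by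
    have hsub : Set.Iic c' ⊆ Set.Iic c ∪
        ⋃ k ∈ Finset.univ, (fun x : ι → ℝ => x k) ⁻¹' Metric.closedBall (c k) (κ k) := by
      intro x hx
      by_cases hxc : x ≤ c
      · exact Or.inl hxc
      · obtain ⟨k, hk⟩ := not_forall.1 hxc
        refine Or.inr (Set.mem_biUnion (Finset.mem_univ k) ?_)
        rw [Set.mem_preimage, Metric.mem_closedBall, Real.dist_eq, abs_le]
        have := hx k; have := hcc k; have := hrκ k
        constructor <;> linarith
    refine (measureReal_mono hsub).trans ((measureReal_union_le _ _).trans ?_)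
    gcongr
    refine (measureReal_biUnion_finset_le _ _).trans ?_
    calc _ ≤ ∑ k : ι, a := by
          refine Finset.sum_le_sum fun k _ => ENNReal.toReal_le_of_le_ofReal ha.le ?_
          rw [← Measure.map_apply (by fun_prop) Metric.isClosed_closedBall.measurableSet]
          exact hκa k (c k)
      _ ≤ ε / 2 := by
          rw [Finset.sum_const, nsmul_eq_mul, ha_def, Finset.card_univ]
          have : (0 : ℝ) ≤ Fintype.card ι := by positivity
          rw [mul_div_assoc', div_le_iff₀ (by positivity)]
          nlinarith
  have hthick (c : ι → ℝ) : Metric.thickening r (Set.Iic c) ⊆ Set.Iic fun k => c k + r := by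
    intro x hx k
    obtain ⟨z, hz, hxz⟩ := Metric.mem_thickening_iff.1 hx
    have h1 := (dist_le_pi_dist x z k).trans hxz.le
    rw [Real.dist_eq] at h1
    have h2 := (abs_le.1 h1).2
    have h3 : z k ≤ c k := hz k
    change x k ≤ c k + r
    linarith
  have hnear : ∀ᶠ R : ProbabilityMeasure (ι → ℝ) in 𝓝 Q,
      levyProkhorovEDist (R : Measure (ι → ℝ)) Q < ENNReal.ofReal r := by
    have h := (LevyProkhorov.probabilityMeasureHomeomorph (Ω := ι → ℝ)).continuous.tendsto Q
    have h' := h.eventually (Metric.ball_mem_nhds _ hr)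
    filter_upwards [h'] with R hR
    have hR' : (levyProkhorovEDist (R : Measure (ι → ℝ)) Q).toReal < r := Metric.mem_ball.1 hR
    exact (ENNReal.lt_ofReal_iff_toReal_lt (levyProkhorovEDist_ne_top _ _)).2 hR'
  have hreal {μ ν : Measure (ι → ℝ)} [IsProbabilityMeasure μ] [IsProbabilityMeasure ν]
      {s t : Set (ι → ℝ)} (h : μ s ≤ ν t + ENNReal.ofReal r) : μ.real s ≤ ν.real t + r := by
    have h' := ENNReal.toReal_mono (by simp) h
    rwa [ENNReal.toReal_add (measure_ne_top _ _) ENNReal.ofReal_ne_top,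
      ENNReal.toReal_ofReal hr.le] at h'
  filter_upwards [hnear] with R hR c
  have hup := left_measure_le_of_levyProkhorovEDist_lt hR (measurableSet_Iic (a := c))
  have hlo := right_measure_le_of_levyProkhorovEDist_lt hR
    (measurableSet_Iic (a := fun k => c k - r))
  rw [ENNReal.toReal_ofReal hr.le] at hup hlo
  have hup' := hreal (hup.trans (add_le_add_left (measure_mono (hthick c)) _))
  have hlo' := hreal (hlo.trans (add_le_add_left (measure_mono (hthick _)) _))
  simp only [sub_add_cancel] at hlo'
  have h1 := hslab c (fun k => c k + r) fun k => le_rfl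
  have h2 := hslab (fun k => c k - r) c fun k => by simp
  rw [abs_le]
  change _ ≤ R.toMeasure.real (Set.Iic c) + r at hlo'
  constructor <;> linarith

/-! ### Laws of large numbers -/

section LLN

variable {Ω : Type*} [MeasurableSpace Ω] {P : Measure Ω} [IsProbabilityMeasure P]

theorem tendsto_average_inProb_of_identDistrib {X : ℕ → Ω → ℝ} {Y : Ω → ℝ} (hY : Integrable Y P)
    (hindep : Pairwise fun i j => IndepFun (X i) (X j) P)
    (hident : ∀ i, IdentDistrib (X i) Y P P) :
    Tendsto (fun x : ℕ × Ω => (∑ i ∈ Finset.range x.1, X i x.2) / x.1) (inProb P)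
      (𝓝 (∫ ω, Y ω ∂P)) := by
  rw [← tendstoInMeasure_const_iff_tendsto_inProb
    (f := fun (n : ℕ) ω => (∑ i ∈ Finset.range n, X i ω) / n)]
  have hX (i) : Integrable (X i) P := (hident i).integrable_iff.2 hY
  refine tendstoInMeasure_of_tendsto_ae (fun n => ?_) ?_
  · exact ((integrable_finsetSum _ fun i _ => hX i).div_const _).aestronglyMeasurable
  · rw [← (hident 0).integral_eq]
    exact strong_law_ae_real X (hX 0) hindep fun i => (hident i).trans (hident 0).symm

/-- The empirical measures of pairwise independent, identically distributed random elements
converge weakly in probability to their common distribution. -/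
theorem tendsto_empirical_inProb {E : Type*} [MeasurableSpace E] [TopologicalSpace E]
    [OpensMeasurableSpace E] {X : ℕ → Ω → E} {Y : Ω → E}
    (hindep : Pairwise fun i j => IndepFun (X i) (X j) P)
    (hident : ∀ i, IdentDistrib (X i) Y P P) {Q : ProbabilityMeasure E}
    (hQ : (Q : Measure E) = P.map Y) :
    Tendsto (fun x : ℕ × Ω => empirical x.1 fun i => X i x.2) (inProb P) (𝓝 Q) := by
  rw [ProbabilityMeasure.tendsto_iff_forall_integral_tendsto]
  intro f
  have hY : AEMeasurable Y P := (hident 0).aemeasurable_snd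
  have hfm : Measurable f := f.continuous.measurable
  have hfY : Integrable (fun ω => f (Y ω)) P :=
    Integrable.of_bound (hfm.comp_aemeasurable hY).aestronglyMeasurable ‖f‖
      (Eventually.of_forall fun ω => f.norm_coe_le_norm _)
  have h := tendsto_average_inProb_of_identDistrib (X := fun i ω => f (X i ω)) hfY
    (fun i j hij => (hindep hij).comp hfm hfm) fun i => (hident i).comp hfm
  rw [hQ, integral_map hY hfm.aestronglyMeasurable]
  refine h.congr' ?_
  filter_upwards [(tendsto_fst_inProb P).eventually (eventually_ne_atTop 0)] with x hx
  rw [integral_empirical hx _ hfm]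

/-- Chebyshev's weak law of large numbers for centred, not necessarily identically distributed
random variables. -/
theorem tendsto_average_inProb_zero {X : ℕ → Ω → ℝ} (hX : ∀ i, MemLp (X i) 2 P)
    (hindep : Pairwise fun i j => IndepFun (X i) (X j) P) (hmean : ∀ i, ∫ ω, X i ω ∂P = 0)
    {C : ℝ} (hC : ∀ i, ∫ ω, X i ω ^ 2 ∂P ≤ C) :
    Tendsto (fun x : ℕ × Ω => (∑ i ∈ Finset.range x.1, X i x.2) / x.1) (inProb P) (𝓝 0) := by
  rw [← tendstoInMeasure_const_iff_tendsto_inProb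
    (f := fun (n : ℕ) ω => (∑ i ∈ Finset.range n, X i ω) / n), tendstoInMeasure_iff_norm]
  intro ε hε
  have hlim : Tendsto (fun n : ℕ => ENNReal.ofReal (C / ε ^ 2 / n)) atTop (𝓝 0) := by
    rw [← ENNReal.ofReal_zero]
    exact ENNReal.tendsto_ofReal (tendsto_const_div_atTop_nhds_zero_nat _)
  refine tendsto_of_tendsto_of_tendsto_of_le_of_le' tendsto_const_nhds hlim
    (Eventually.of_forall fun _ => zero_le) ?_
  filter_upwards [eventually_ne_atTop 0] with n hn
  have hn' : (0 : ℝ) < n := by positivity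
  have hvar : Var[∑ i ∈ Finset.range n, X i; P] ≤ n * C := by
    rw [IndepFun.variance_sum (fun i _ => hX i) fun i _ j _ hij => hindep hij]
    calc _ ≤ ∑ i ∈ Finset.range n, C := Finset.sum_le_sum fun i _ => by
          rw [variance_of_integral_eq_zero (hX i).1.aemeasurable (hmean i)]
          exact hC i
      _ = n * C := by simp
  have hS : MemLp (∑ i ∈ Finset.range n, X i) 2 P := memLp_finsetSum' _ fun i _ => hX i
  have hSmean : ∫ ω, (∑ i ∈ Finset.range n, X i) ω ∂P = 0 := by
    simp only [Finset.sum_apply]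
    rw [integral_finsetSum _ fun i _ => (hX i).integrable (by norm_num)]
    exact Finset.sum_eq_zero fun i _ => hmean i
  have hcheb := meas_ge_le_variance_div_sq hS (mul_pos hε hn')
  rw [hSmean] at hcheb
  refine (measure_mono fun ω hω => ?_).trans (hcheb.trans (ENNReal.ofReal_le_ofReal ?_))
  · rw [Set.mem_ofPred_eq, sub_zero, Real.norm_eq_abs, abs_div, abs_of_pos hn', le_div_iff₀ hn'] at hω
    simpa using hω
  · calc _ ≤ n * C / (ε * n) ^ 2 := by gcongr
      _ = C / ε ^ 2 / n := by field_simp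

end LLN

/-! ### Spectral norm bounds -/

section SpectralNorm

variable {K : ℕ}

/-- The Euclidean norm on `Fin K → ℝ`, whose own norm is the supremum norm. -/
noncomputable def euclNorm (x : Fin K → ℝ) : ℝ := ‖WithLp.toLp 2 x‖

theorem euclNorm_nonneg (x : Fin K → ℝ) : 0 ≤ euclNorm x := norm_nonneg _

theorem euclNorm_add_le (x y : Fin K → ℝ) : euclNorm (x + y) ≤ euclNorm x + euclNorm y := by
  simpa [euclNorm] using norm_add_le (WithLp.toLp 2 x) (WithLp.toLp 2 y)

theorem euclNorm_sub_le (x y : Fin K → ℝ) : euclNorm (x - y) ≤ euclNorm x + euclNorm y := by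
  simpa [euclNorm] using norm_sub_le (WithLp.toLp 2 x) (WithLp.toLp 2 y)

theorem abs_apply_le_euclNorm (x : Fin K → ℝ) (k : Fin K) : |x k| ≤ euclNorm x :=
  PiLp.norm_apply_le (WithLp.toLp 2 x) k

theorem dist_le_euclNorm_sub (x y : Fin K → ℝ) : dist x y ≤ euclNorm (x - y) :=
  (dist_pi_le_iff (euclNorm_nonneg _)).2 fun k => abs_apply_le_euclNorm (x - y) k

theorem euclNorm_sq (x : Fin K → ℝ) : euclNorm x ^ 2 = ∑ k, x k ^ 2 := by
  simp [euclNorm, EuclideanSpace.norm_sq_eq]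

theorem continuous_euclNorm : Continuous (euclNorm : (Fin K → ℝ) → ℝ) :=
  (PiLp.continuous_toLp 2 _).norm

theorem euclNorm_mulVec_le (M : Matrix (Fin K) (Fin K) ℝ) (x : Fin K → ℝ) :
    euclNorm (M *ᵥ x) ≤ specNorm M * euclNorm x :=
  (Matrix.toEuclideanCLM (n := Fin K) (𝕜 := ℝ) M).le_opNorm (WithLp.toLp 2 x)

theorem specNorm_nonneg (M : Matrix (Fin K) (Fin K) ℝ) : 0 ≤ specNorm M := norm_nonneg _

theorem specNorm_sub_rev (M N : Matrix (Fin K) (Fin K) ℝ) :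
    specNorm (M - N) = specNorm (N - M) := by
  simp only [specNorm, map_sub, norm_sub_rev]

theorem specNorm_le_add_sub (M N : Matrix (Fin K) (Fin K) ℝ) :
    specNorm M ≤ specNorm N + specNorm (M - N) := by
  simp only [specNorm, map_sub]
  exact norm_le_norm_add_norm_sub' _ _

open scoped MatrixOrder in
theorem mul_euclNorm_le_of_forall_spectrum {M : Matrix (Fin K) (Fin K) ℝ} (hM : M.IsHermitian)
    {h : ℝ} (hspec : ∀ μ ∈ spectrum ℝ M, h ≤ μ) (x : Fin K → ℝ) :
    h * euclNorm x ≤ euclNorm (M *ᵥ x) := by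
  have hle : algebraMap ℝ _ h ≤ M := (algebraMap_le_iff_le_spectrum (ha := hM)).2 hspec
  have hpsd : (M - algebraMap ℝ _ h).PosSemidef := Matrix.le_iff.1 hle
  have hx : 0 ≤ x ⬝ᵥ ((M - algebraMap ℝ _ h) *ᵥ x) := by
    simpa using hpsd.dotProduct_mulVec_nonneg x
  rw [Matrix.sub_mulVec, dotProduct_sub, Algebra.algebraMap_eq_smul_one, Matrix.smul_mulVec,
    Matrix.one_mulVec, dotProduct_smul, smul_eq_mul] at hx
  have hsq : x ⬝ᵥ x = euclNorm x ^ 2 := by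
    rw [euclNorm_sq]; simp [dotProduct, sq]
  have hcs : x ⬝ᵥ (M *ᵥ x) ≤ euclNorm x * euclNorm (M *ᵥ x) := by
    have := real_inner_le_norm (WithLp.toLp 2 x) (WithLp.toLp 2 (M *ᵥ x))
    rwa [EuclideanSpace.inner_toLp_toLp, star_trivial, dotProduct_comm] at this
  rcases (euclNorm_nonneg x).eq_or_lt with h0 | h0
  · rw [← h0, mul_zero]; exact euclNorm_nonneg _
  · rw [hsq] at hx
    nlinarith

/-- Stability of the rescaled residual: with the estimated matrices `M` and `H` within `e` of the
true ones `M₀` and `H₀`, the vector `M H⁻¹ (H₀ z - m)` is close to `M₀ z` when `e` and `m` are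
small. -/
theorem euclNorm_rescale_sub_le {M M₀ H H₀ : Matrix (Fin K) (Fin K) ℝ} {h U e : ℝ} (hh : 0 < h)
    (hlow : ∀ x, h * euclNorm x ≤ euclNorm (H₀ *ᵥ x)) (hM₀ : specNorm M₀ ≤ U)
    (he : e ≤ h / 2) (hM : specNorm (M - M₀) ≤ e) (hH : specNorm (H - H₀) ≤ e)
    (z m : Fin K → ℝ) :
    euclNorm (M *ᵥ (H⁻¹ *ᵥ (H₀ *ᵥ z - m)) - M₀ *ᵥ z) ≤
      (U + h / 2) * (2 / h) * (e * euclNorm z + euclNorm m) + e * euclNorm z := by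
  have he0 : 0 ≤ e := (specNorm_nonneg _).trans hM
  have hHlow (x : Fin K → ℝ) : h / 2 * euclNorm x ≤ euclNorm (H *ᵥ x) := by
    have h1 := euclNorm_sub_le (H *ᵥ x) ((H - H₀) *ᵥ x)
    rw [← Matrix.sub_mulVec, sub_sub_cancel] at h1
    have h2 := euclNorm_mulVec_le (H - H₀) x
    have h3 := hlow x
    have h4 := mul_le_mul_of_nonneg_right (hH.trans he) (euclNorm_nonneg x)
    linarith
  have hunit : IsUnit H := by
    rw [← Matrix.mulVec_injective_iff_isUnit]
    refine (injective_iff_map_eq_zero H.mulVecLin).2 fun x hx => ?_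
    have hx' : H *ᵥ x = 0 := hx
    have h1 := hHlow x
    rw [hx'] at h1
    have h2 : euclNorm (0 : Fin K → ℝ) = 0 := by simp [euclNorm]
    have h3 : euclNorm x = 0 := by
      have := euclNorm_nonneg x
      nlinarith
    simpa [euclNorm] using h3
  set y := H⁻¹ *ᵥ (H₀ *ᵥ z - m) with hy_def
  have hy : H *ᵥ y = H₀ *ᵥ z - m := by
    rw [hy_def, Matrix.mulVec_mulVec,
      Matrix.mul_nonsing_inv _ ((Matrix.isUnit_iff_isUnit_det _).1 hunit), Matrix.one_mulVec]
  have hyz : euclNorm (y - z) ≤ 2 / h * (e * euclNorm z + euclNorm m) := by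
    have h1 : H *ᵥ (y - z) = (H₀ - H) *ᵥ z - m := by
      rw [Matrix.mulVec_sub, hy, Matrix.sub_mulVec]; abel
    have h2 := hHlow (y - z)
    rw [h1] at h2
    have h3 := euclNorm_sub_le ((H₀ - H) *ᵥ z) m
    have h4 := euclNorm_mulVec_le (H₀ - H) z
    rw [specNorm_sub_rev] at h4
    have h5 := mul_le_mul_of_nonneg_right hH (euclNorm_nonneg z)
    rw [div_mul_eq_mul_div, le_div_iff₀ hh]
    linarith
  have hsplit : M *ᵥ y - M₀ *ᵥ z = M *ᵥ (y - z) + (M - M₀) *ᵥ z := by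
    rw [Matrix.mulVec_sub, Matrix.sub_mulVec]; abel
  have hMU : specNorm M ≤ U + h / 2 := (specNorm_le_add_sub M M₀).trans (by linarith)
  rw [hsplit, mul_assoc]
  refine (euclNorm_add_le _ _).trans (add_le_add ?_ ?_)
  · refine (euclNorm_mulVec_le _ _).trans ?_
    exact mul_le_mul hMU hyz (euclNorm_nonneg _) ((specNorm_nonneg _).trans hMU)
  · refine (euclNorm_mulVec_le _ _).trans ?_
    exact mul_le_mul_of_nonneg_right hM (euclNorm_nonneg _)

end SpectralNorm

/-! ### Atoms of sums of independent variables -/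

/-- A sum of two independent random variables inherits the absence of atoms from one of them. -/
theorem measure_add_eq_zero_of_indepFun {Ω : Type*} [MeasurableSpace Ω] {P : Measure Ω}
    [IsProbabilityMeasure P] {X Y : Ω → ℝ} (hX : Measurable X) (hY : Measurable Y)
    (hXY : IndepFun X Y P) (hY0 : ∀ b, P {ω | Y ω = b} = 0) (b : ℝ) :
    P {ω | X ω + Y ω = b} = 0 := by
  have hs : MeasurableSet {p : ℝ × ℝ | p.1 + p.2 = b} :=
    measurableSet_eq_fun (by fun_prop) measurable_const
  have h := (indepFun_iff_map_prod_eq_prod_map_map hX.aemeasurable hY.aemeasurable).1 hXY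
  change P ((fun ω => (X ω, Y ω)) ⁻¹' {p : ℝ × ℝ | p.1 + p.2 = b}) = 0
  rw [← Measure.map_apply (by fun_prop) hs, h, Measure.measure_prod_null hs]
  refine Eventually.of_forall fun x => ?_
  have hset : Prod.mk x ⁻¹' {p : ℝ × ℝ | p.1 + p.2 = b} = {b - x} := by
    ext y; simp [eq_sub_iff_add_eq']
  change Measure.map Y P (Prod.mk x ⁻¹' _) = 0
  rw [hset, Measure.map_apply hY (measurableSet_singleton _)]
  exact hY0 _

/-! ### Empirical measures of the rescaled residuals -/

section RescaledResiduals

variable {Ω : Type*} [MeasurableSpace Ω] {P : Measure Ω} {K : ℕ}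

theorem integrable_euclNorm_sq {z : Ω → Fin K → ℝ} (hz : ∀ k, MemLp (fun ω => z ω k) 2 P) :
    Integrable (fun ω => euclNorm (z ω) ^ 2) P := by
  simp_rw [euclNorm_sq]
  exact integrable_finsetSum _ fun k _ => (hz k).integrable_sq

theorem integrable_euclNorm [IsFiniteMeasure P] {z : Ω → Fin K → ℝ} (hzm : AEMeasurable z P)
    (hz : ∀ k, MemLp (fun ω => z ω k) 2 P) : Integrable (fun ω => euclNorm (z ω)) P := by
  refine ((integrable_const (1 : ℝ)).add (integrable_euclNorm_sq hz)).mono'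
    (continuous_euclNorm.measurable.comp_aemeasurable hzm).aestronglyMeasurable
    (Eventually.of_forall fun ω => ?_)
  rw [Real.norm_eq_abs, abs_of_nonneg (euclNorm_nonneg _), Pi.add_apply]
  nlinarith [sq_nonneg (euclNorm (z ω) - 1), euclNorm_nonneg (z ω)]

/-- The mean of the heteroskedastic vectors `H₀ i *ᵥ ζ i` vanishes asymptotically. -/
theorem tendsto_euclNorm_mean_inProb [IsProbabilityMeasure P] {ζ : ℕ → Ω → Fin K → ℝ} {ζ₀ : Ω → Fin K → ℝ}
    (hindep : Pairwise fun i j => IndepFun (ζ i) (ζ j) P)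
    (hident : ∀ i, IdentDistrib (ζ i) ζ₀ P P) (hL2 : ∀ k, MemLp (fun ω => ζ₀ ω k) 2 P)
    (hmean : ∀ k, ∫ ω, ζ₀ ω k ∂P = 0) {H₀ : ℕ → Matrix (Fin K) (Fin K) ℝ} {U : ℝ}
    (hU : ∀ i, specNorm (H₀ i) ≤ U) :
    Tendsto (fun x : ℕ × Ω => euclNorm
      ((1 / (x.1 : ℝ)) • ∑ i ∈ Finset.range x.1, H₀ i *ᵥ ζ i x.2)) (inProb P) (𝓝 0) := by
  have hζ2 (i k) : MemLp (fun ω => ζ i ω k) 2 P :=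
    ((hident i).comp (measurable_pi_apply k)).memLp_iff.2 (hL2 k)
  have hζ0 (i k) : ∫ ω, ζ i ω k ∂P = 0 :=
    ((hident i).comp (measurable_pi_apply k)).integral_eq.trans (hmean k)
  have hmv (M : Matrix (Fin K) (Fin K) ℝ) (k : Fin K) : Measurable fun z : Fin K → ℝ => (M *ᵥ z) k :=
    measurable_pi_iff.1 (Continuous.matrix_mulVec continuous_const continuous_id).measurable k
  have hcoord (k : Fin K) : Tendsto
      (fun x : ℕ × Ω => (∑ i ∈ Finset.range x.1, (H₀ i *ᵥ ζ i x.2) k) / x.1) (inProb P)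
      (𝓝 0) := by
    refine tendsto_average_inProb_zero (X := fun i ω => (H₀ i *ᵥ ζ i ω) k)
      (C := U ^ 2 * ∫ ω, euclNorm (ζ₀ ω) ^ 2 ∂P) (fun i => ?_)
      (fun i j hij => (hindep hij).comp (hmv (H₀ i) k) (hmv (H₀ j) k)) (fun i => ?_) fun i => ?_
    · simp only [Matrix.mulVec, dotProduct]
      exact memLp_finsetSum _ fun l _ => (hζ2 i l).const_mul _
    · simp only [Matrix.mulVec, dotProduct]
      rw [integral_finsetSum _ fun l _ => ((hζ2 i l).integrable (by norm_num)).const_mul _]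
      simp [integral_const_mul, hζ0]
    · have hid := (hident i).comp (continuous_euclNorm.measurable.pow_const 2)
      have hsq : ∫ ω, euclNorm (ζ i ω) ^ 2 ∂P = ∫ ω, euclNorm (ζ₀ ω) ^ 2 ∂P := hid.integral_eq
      rw [← hsq, ← integral_const_mul]
      refine integral_mono_of_nonneg (Eventually.of_forall fun ω => sq_nonneg _)
        ((integrable_euclNorm_sq (hζ2 i)).const_mul _) (Eventually.of_forall fun ω => ?_)
      change (H₀ i *ᵥ ζ i ω) k ^ 2 ≤ U ^ 2 * euclNorm (ζ i ω) ^ 2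
      rw [← mul_pow, ← sq_abs]
      gcongr
      exact (abs_apply_le_euclNorm _ k).trans ((euclNorm_mulVec_le _ _).trans
        (mul_le_mul_of_nonneg_right (hU i) (euclNorm_nonneg _)))
  have h := (continuous_euclNorm.tendsto (0 : Fin K → ℝ)).comp
    (tendsto_pi_nhds.2 hcoord : Tendsto (fun (x : ℕ × Ω) k =>
      (∑ i ∈ Finset.range x.1, (H₀ i *ᵥ ζ i x.2) k) / x.1) (inProb P) (𝓝 0))
  have h0 : euclNorm (0 : Fin K → ℝ) = 0 := by simp [euclNorm]
  rw [h0] at h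
  refine h.congr fun x => congrArg euclNorm ?_
  ext k
  simp [Finset.sum_apply, div_eq_inv_mul]

/-- The vectors obtained by standardizing the centred control vectors `H₀ i *ᵥ ζ i` with the
estimates `Hh i` and rescaling with the estimate `Mh` of `M₀` have empirical measures that
converge weakly in probability to the law of `M₀ *ᵥ ζ₀`. -/
theorem tendsto_empirical_rescaled_inProb [IsProbabilityMeasure P]
    {ζ : ℕ → Ω → Fin K → ℝ} {ζ₀ : Ω → Fin K → ℝ}
    (hindep : Pairwise fun i j => IndepFun (ζ i) (ζ j) P)
    (hident : ∀ i, IdentDistrib (ζ i) ζ₀ P P) (hL2 : ∀ k, MemLp (fun ω => ζ₀ ω k) 2 P)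
    (hmean : ∀ k, ∫ ω, ζ₀ ω k ∂P = 0)
    {H₀ : ℕ → Matrix (Fin K) (Fin K) ℝ} {M₀ : Matrix (Fin K) (Fin K) ℝ} {h U : ℝ} (hh : 0 < h)
    (hlow : ∀ i x, h * euclNorm x ≤ euclNorm (H₀ i *ᵥ x))
    (hU : ∀ i, specNorm (H₀ i) ≤ U) (hM₀ : specNorm M₀ ≤ U)
    {Hh : ℕ × Ω → ℕ → Matrix (Fin K) (Fin K) ℝ} {Mh : ℕ × Ω → Matrix (Fin K) (Fin K) ℝ}
    {e : ℕ × Ω → ℝ} (he : Tendsto e (inProb P) (𝓝 0))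
    (hHe : ∀ x, ∀ i < x.1, specNorm (Hh x i - H₀ i) ≤ e x)
    (hMe : ∀ x, specNorm (Mh x - M₀) ≤ e x) {Q : ProbabilityMeasure (Fin K → ℝ)}
    (hQ : (Q : Measure (Fin K → ℝ)) = P.map fun ω => M₀ *ᵥ ζ₀ ω) :
    Tendsto (fun x : ℕ × Ω => empirical x.1 fun i => Mh x *ᵥ ((Hh x i)⁻¹ *ᵥ (H₀ i *ᵥ ζ i x.2 -
      (1 / (x.1 : ℝ)) • ∑ i' ∈ Finset.range x.1, H₀ i' *ᵥ ζ i' x.2))) (inProb P) (𝓝 Q) := by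
  have hmv : Measurable fun z : Fin K → ℝ => M₀ *ᵥ z :=
    (Continuous.matrix_mulVec continuous_const continuous_id).measurable
  have hne : ∀ᶠ x : ℕ × Ω in inProb P, x.1 ≠ 0 :=
    (tendsto_fst_inProb P).eventually (eventually_ne_atTop 0)
  have horacle : Tendsto (fun x : ℕ × Ω => empirical x.1 fun i => M₀ *ᵥ ζ i x.2) (inProb P)
      (𝓝 Q) :=
    tendsto_empirical_inProb (X := fun i ω => M₀ *ᵥ ζ i ω)
      (fun i j hij => (hindep hij).comp hmv hmv) (fun i => (hident i).comp hmv) hQ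
  refine tendsto_empirical_of_tendsto_dist hne horacle ?_
  have hm := tendsto_euclNorm_mean_inProb hindep hident hL2 hmean hU
  have hζ := tendsto_average_inProb_of_identDistrib (X := fun i ω => euclNorm (ζ i ω))
    (integrable_euclNorm (hident 0).aemeasurable_snd hL2)
    (fun i j hij => (hindep hij).comp continuous_euclNorm.measurable continuous_euclNorm.measurable)
    fun i => (hident i).comp continuous_euclNorm.measurable
  set C := (U + h / 2) * (2 / h)
  have hbound := (((he.mul hζ).add hm).const_mul C).add (he.mul hζ)
  simp only [zero_mul, add_zero, mul_zero] at hbound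
  refine tendsto_of_tendsto_of_tendsto_of_le_of_le' tendsto_const_nhds hbound
    (Eventually.of_forall fun x => by positivity) ?_
  filter_upwards [hne, he.eventually_le_const (half_pos hh)] with x hx hex
  have hx' : (0 : ℝ) < x.1 := by positivity
  set m := (1 / (x.1 : ℝ)) • ∑ i' ∈ Finset.range x.1, H₀ i' *ᵥ ζ i' x.2
  calc _ ≤ (∑ i ∈ Finset.range x.1, (C * (e x * euclNorm (ζ i x.2) + euclNorm m) +
          e x * euclNorm (ζ i x.2))) / x.1 := by
        gcongr with i hi
        exact (dist_le_euclNorm_sub _ _).trans (euclNorm_rescale_sub_le hh (hlow i) hM₀ hex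
          (hMe x) (hHe x i (Finset.mem_range.1 hi)) _ _)
    _ = _ := by
        rw [Finset.sum_add_distrib, ← Finset.mul_sum, Finset.sum_add_distrib, ← Finset.mul_sum,
          Finset.sum_const, Finset.card_range, nsmul_eq_mul]
        field_simp

end RescaledResiduals

/-! ### Residuals and the bootstrap distribution -/

/-- Differencing removes the unit effects, because the rows of the aggregation matrix sum to zero,
and centring removes the time effects. -/
theorem residual_observedOutcome {N₁ T K : ℕ} {Kb : Fin N₁ → ℕ} {Ω : Type*}
    (tStar : Fin N₁ → ℕ) (A : (j : Fin N₁) → Matrix (Fin (Kb j)) (Fin T) ℝ)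
    (B : (j : Fin N₁) → Matrix (Fin K) (Fin (Kb j)) ℝ)
    (α : Units N₁ → Fin T → ℝ) (θ : Units N₁ → Ω → ℝ)
    (γ : Fin T → Ω → ℝ) (η : Units N₁ → Ω → Fin T → ℝ) (ω : Ω) {n : ℕ} (hn : n ≠ 0) (j : Fin N₁)
    (hrow : ∀ k, ∑ t, (B j * A j) k t = 0) (i : ℕ) :
    residual A B (fun i => observedOutcome tStar α θ γ η i ω) n j i =
      (B j * A j) *ᵥ η (Sum.inr i) ω
        - (1 / (n : ℝ)) • ∑ i' ∈ Finset.range n, (B j * A j) *ᵥ η (Sum.inr i') ω := by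
  have hY (i : ℕ) : (B j * A j) *ᵥ observedOutcome tStar α θ γ η (Sum.inr i) ω =
      (B j * A j) *ᵥ (fun t => γ t ω) + (B j * A j) *ᵥ η (Sum.inr i) ω := by
    have hsplit : observedOutcome tStar α θ γ η (Sum.inr i) ω =
        (fun _ => θ (Sum.inr i) ω) + ((fun t => γ t ω) + η (Sum.inr i) ω) := by
      ext t
      simp [observedOutcome, lastUntreated, outcomeUntreated, add_assoc]
    have hθ : (B j * A j) *ᵥ (fun _ : Fin T => θ (Sum.inr i) ω) = 0 := by
      ext k
      simp only [Matrix.mulVec, dotProduct, ← Finset.sum_mul, hrow k, zero_mul, Pi.zero_apply]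
    rw [hsplit, Matrix.mulVec_add, Matrix.mulVec_add, hθ, zero_add]
  have hn' : (n : ℝ) ≠ 0 := by positivity
  simp only [residual, hY, Finset.sum_add_distrib, Finset.sum_const, Finset.card_range, smul_add]
  rw [← Nat.cast_smul_eq_nsmul ℝ, smul_smul, one_div_mul_cancel hn', one_smul]
  abel

/-- The bootstrap distribution function is the distribution function of a sum of independent draws
from the empirical measures of the rescaled residuals. -/
theorem bootstrapCDF_eq_measureReal {N₁ T K : ℕ} {Kb : Fin N₁ → ℕ} {𝒵 : Type*}
    (A : (j : Fin N₁) → Matrix (Fin (Kb j)) (Fin T) ℝ)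
    (B : (j : Fin N₁) → Matrix (Fin K) (Fin (Kb j)) ℝ)
    (Y : Units N₁ → Fin T → ℝ) (Z : Units N₁ → 𝒵)
    {p : Fin N₁ → ℕ} {Δ : (j : Fin N₁) → Set (Fin (p j) → ℝ)}
    (H : (j : Fin N₁) → 𝒵 → Δ j → Matrix (Fin K) (Fin K) ℝ) (d : (j : Fin N₁) → Δ j)
    {n : ℕ} (hn : n ≠ 0) (c : Fin K → ℝ) :
    bootstrapCDF A B Y Z H d n c =
      ((Measure.pi fun j => (empirical n fun i => H j (Z (Sum.inl j)) (d j) *ᵥ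
        scaledResidual A B Y Z H d n j i : Measure (Fin K → ℝ))).map fun x => ∑ j, x j).real
          (Set.Iic c) := by
  classical
  rw [measureReal_map_sum_pi_empirical hn _ measurableSet_Iic, Fintype.card_fin]
  simp only [bootstrapCDF, Set.mem_Iic]

end FewTreatedDID

theorem proposition2 {Ω 𝒵 : Type*} [MeasurableSpace Ω] (P : Measure Ω) [IsProbabilityMeasure P]
    {N₁ T K : ℕ}
    -- the design: last untreated periods, and the aggregation matrices
    (tStar : Fin N₁ → ℕ) (htStar : ∀ j, 1 ≤ tStar j ∧ tStar j ≤ T - 1)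
    {Kb : Fin N₁ → ℕ} (A : (j : Fin N₁) → Matrix (Fin (Kb j)) (Fin T) ℝ)
    (B : (j : Fin N₁) → Matrix (Fin K) (Fin (Kb j)) ℝ)
    -- treatment effects, unit effects, time effects, errors, covariates
    (α : FewTreatedDID.Units N₁ → Fin T → ℝ) (θ : FewTreatedDID.Units N₁ → Ω → ℝ)
    (γ : Fin T → Ω → ℝ) (η : FewTreatedDID.Units N₁ → Ω → Fin T → ℝ)
    (Z : FewTreatedDID.Units N₁ → 𝒵)
    -- the model of heteroskedasticity, its parameters, and their estimators with `n` controls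
    {p : Fin N₁ → ℕ} {Δ : (j : Fin N₁) → Set (Fin (p j) → ℝ)}
    (H : (j : Fin N₁) → 𝒵 → Δ j → Matrix (Fin K) (Fin K) ℝ) (δ : (j : Fin N₁) → Δ j)
    (ξ : FewTreatedDID.Units N₁ → Fin N₁ → Ω → Fin K → ℝ)
    (δhat : ℕ → Ω → (j : Fin N₁) → Δ j)
    (hSampling : FewTreatedDID.Sampling P η)
    (hTrends : FewTreatedDID.ParallelTrends P A B η)
    (hModel : FewTreatedDID.ParametricModel P A B η Z H δ ξ)
    -- uniform consistency of the estimated scale matrices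
    (hConsistent : ∀ j : Fin N₁, TendstoInMeasure P
      (fun (n : ℕ) (ω : Ω) => (FewTreatedDID.comparisonUnits j n).sup'
        (FewTreatedDID.comparisonUnits_nonempty j n)
        (fun i => FewTreatedDID.specNorm (H j (Z i) (δhat n ω j) - H j (Z i) (δ j))))
      atTop (fun _ => (0 : ℝ)))
    -- eigenvalue bounds
    (hLow hUp : ℝ) (hLow_pos : 0 < hLow) (hLow_le : hLow ≤ hUp)
    (hEigen : ∀ (j : Fin N₁) (i : ℕ), ∀ μ ∈ spectrum ℝ (H j (Z (Sum.inr i)) (δ j)), hLow ≤ μ)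
    (hNorm : ∀ (j : Fin N₁) (i : FewTreatedDID.Units N₁), FewTreatedDID.IsComparison j i →
      FewTreatedDID.specNorm (H j (Z i) (δ j)) ≤ hUp) :
    TendstoInMeasure P
      (fun (n : ℕ) (ω : Ω) => ⨆ c : Fin K → ℝ,
        |FewTreatedDID.bootstrapCDF A B
            (fun i => FewTreatedDID.observedOutcome tStar α θ γ η i ω) Z H (δhat n ω) n c
          - FewTreatedDID.targetCDF P A B η c|)
      atTop (fun _ => (0 : ℝ)) := by
  have hinl (j : Fin N₁) : FewTreatedDID.IsComparison j (Sum.inl j) := Or.inl rfl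
  have hinr (j : Fin N₁) (i : ℕ) : FewTreatedDID.IsComparison j (Sum.inr i) := Or.inr ⟨i, rfl⟩
  have hmv {m k : ℕ} (M : Matrix (Fin m) (Fin k) ℝ) : Measurable fun z : Fin k → ℝ => M *ᵥ z :=
    (Continuous.matrix_mulVec continuous_const continuous_id).measurable
  let S : Fin N₁ → Ω → Fin K → ℝ := fun j ω => (B j * A j) *ᵥ η (Sum.inl j) ω
  have hSm (j) : Measurable (S j) := (hmv _).comp (hSampling.measurable _)
  have hSindep : iIndepFun S P :=
    (hSampling.indep.precomp (g := fun j : Fin N₁ => Sum.inl j) Sum.inl_injective).comp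
      (fun j z => (B j * A j) *ᵥ z) fun j => hmv _
  -- a measurable version of the standardized errors that satisfies the model surely
  let ζ (j : Fin N₁) (i : FewTreatedDID.Units N₁) (ω : Ω) : Fin K → ℝ :=
    (H j (Z i) (δ j))⁻¹ *ᵥ ((B j * A j) *ᵥ η i ω)
  have hdet (j : Fin N₁) (i) (hi : FewTreatedDID.IsComparison j i) :
      IsUnit (H j (Z i) (δ j)).det :=
    (Matrix.isUnit_iff_isUnit_det _).1 (hModel.posDef j i hi).isUnit
  have hfactor (j : Fin N₁) (i) (hi : FewTreatedDID.IsComparison j i) (ω) :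
      H j (Z i) (δ j) *ᵥ ζ j i ω = (B j * A j) *ᵥ η i ω := by
    rw [Matrix.mulVec_mulVec, Matrix.mul_nonsing_inv _ (hdet j i hi), Matrix.one_mulVec]
  have hζm (j i) : Measurable (ζ j i) := (hmv _).comp ((hmv _).comp (hSampling.measurable i))
  have hζξ (j : Fin N₁) (i) (hi : FewTreatedDID.IsComparison j i) : ζ j i =ᵐ[P] ξ i j := by
    filter_upwards [hModel.factor j i hi] with ω hω
    change (H j (Z i) (δ j))⁻¹ *ᵥ ((B j * A j) *ᵥ η i ω) = _
    rw [hω, Matrix.mulVec_mulVec, Matrix.nonsing_inv_mul _ (hdet j i hi), Matrix.one_mulVec]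
  have hident (j : Fin N₁) (i : ℕ) : IdentDistrib (ζ j (Sum.inr i)) (ζ j (Sum.inl j)) P P := by
    refine IdentDistrib.trans ?_ ((hModel.identDistrib j _ _ (hinr j i) (hinl j)).trans ?_)
    · exact .of_ae_eq (hζm _ _).aemeasurable (hζξ j _ (hinr j i))
    · exact (IdentDistrib.of_ae_eq (hζm _ _).aemeasurable (hζξ j _ (hinl j))).symm
  have hindep (j : Fin N₁) :
      Pairwise fun i i' : ℕ => IndepFun (ζ j (Sum.inr i)) (ζ j (Sum.inr i')) P := by
    intro i i' hii
    exact (hSampling.indep.indepFun (Sum.inr_injective.ne hii)).comp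
      ((hmv _).comp (hmv _)) ((hmv _).comp (hmv _))
  have hL2mv {m k : ℕ} (M : Matrix (Fin m) (Fin k) ℝ) {z : Ω → Fin k → ℝ}
      (hz : ∀ l, MemLp (fun ω => z ω l) 2 P) (l : Fin m) : MemLp (fun ω => (M *ᵥ z ω) l) 2 P := by
    simp only [Matrix.mulVec, dotProduct]
    exact memLp_finsetSum _ fun l _ => (hz l).const_mul _
  have hL2 (j : Fin N₁) (k) : MemLp (fun ω => ζ j (Sum.inl j) ω k) 2 P :=
    hL2mv _ (hL2mv _ (hSampling.second_moment _)) k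
  have hmean (j : Fin N₁) (k) : ∫ ω, ζ j (Sum.inl j) ω k ∂P = 0 := by
    rw [← (hModel.mean_zero j k).2]
    refine integral_congr_ae ?_
    filter_upwards [hζξ j _ (hinl j)] with ω hω
    rw [hω]
  let Q (j : Fin N₁) : ProbabilityMeasure (Fin K → ℝ) :=
    ⟨P.map (S j), Measure.isProbabilityMeasure_map (hSm j).aemeasurable⟩
  -- the rescaled residuals, unit by unit
  have hunit (j : Fin N₁) : Tendsto (fun x : ℕ × Ω => FewTreatedDID.empirical x.1 fun i =>
      H j (Z (Sum.inl j)) (δhat x.1 x.2 j) *ᵥ FewTreatedDID.scaledResidual A B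
        (fun i => FewTreatedDID.observedOutcome tStar α θ γ η i x.2) Z H (δhat x.1 x.2) x.1 j i)
      (FewTreatedDID.inProb P) (𝓝 (Q j)) := by
    have h := FewTreatedDID.tendsto_empirical_rescaled_inProb
      (ζ := fun i => ζ j (Sum.inr i)) (ζ₀ := ζ j (Sum.inl j)) (hindep j) (hident j) (hL2 j)
      (hmean j) (H₀ := fun i => H j (Z (Sum.inr i)) (δ j)) (M₀ := H j (Z (Sum.inl j)) (δ j))
      hLow_pos (fun i => FewTreatedDID.mul_euclNorm_le_of_forall_spectrum
        (hModel.posDef j _ (hinr j i)).isHermitian (hEigen j i))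
      (fun i => hNorm j _ (hinr j i)) (hNorm j _ (hinl j))
      (Hh := fun x i => H j (Z (Sum.inr i)) (δhat x.1 x.2 j))
      (Mh := fun x => H j (Z (Sum.inl j)) (δhat x.1 x.2 j))
      (FewTreatedDID.tendstoInMeasure_const_iff_tendsto_inProb.1 (hConsistent j))
      (fun x i hi => Finset.le_sup' (fun i => FewTreatedDID.specNorm
          (H j (Z i) (δhat x.1 x.2 j) - H j (Z i) (δ j)))
        (by simpa [FewTreatedDID.comparisonUnits] using hi))
      (fun x => Finset.le_sup' (fun i => FewTreatedDID.specNorm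
          (H j (Z i) (δhat x.1 x.2 j) - H j (Z i) (δ j)))
        (by simp [FewTreatedDID.comparisonUnits]))
      (Q := Q j) (congrArg P.map (funext fun ω => (hfactor j _ (hinl j) ω).symm))
    refine h.congr' ?_
    filter_upwards [(FewTreatedDID.tendsto_fst_inProb P).eventually (eventually_ne_atTop 0)]
      with x hx
    congr 1
    funext i
    simp only [FewTreatedDID.scaledResidual, hfactor j _ (hinr j _)]
    rw [FewTreatedDID.residual_observedOutcome _ _ _ _ _ _ _ _ hx j (hTrends.row_sum j)]
  rw [FewTreatedDID.tendstoInMeasure_const_iff_tendsto_inProb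
    (f := fun (n : ℕ) (ω : Ω) => ⨆ c : Fin K → ℝ,
      |FewTreatedDID.bootstrapCDF A B
          (fun i => FewTreatedDID.observedOutcome tStar α θ γ η i ω) Z H (δhat n ω) n c
        - FewTreatedDID.targetCDF P A B η c|)]
  rcases isEmpty_or_nonempty (Fin N₁) with hempty | ⟨⟨j₀⟩⟩
  · -- without treated units both distribution functions are that of the zero vector
    have hN : N₁ = 0 := by
      by_contra hne
      exact hempty.false ⟨0, Nat.pos_of_ne_zero hne⟩
    subst hN
    have h0 (x : ℕ × Ω) (c : Fin K → ℝ) : FewTreatedDID.bootstrapCDF A B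
        (fun i => FewTreatedDID.observedOutcome tStar α θ γ η i x.2) Z H (δhat x.1 x.2) x.1 c
          - FewTreatedDID.targetCDF P A B η c = 0 := by
      by_cases hc : 0 ≤ c <;> simp [FewTreatedDID.bootstrapCDF, FewTreatedDID.targetCDF, hc]
    simp only [h0, abs_zero, ciSup_const]
    exact tendsto_const_nhds
  have hsum : Continuous fun x : Fin N₁ → Fin K → ℝ => ∑ j, x j := by fun_prop
  let Qsum : ProbabilityMeasure (Fin K → ℝ) :=
    (ProbabilityMeasure.pi Q).map hsum.measurable.aemeasurable
  have hQsum : (Qsum : Measure (Fin K → ℝ)) = P.map fun ω => ∑ j, S j ω := by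
    change (Measure.pi fun j => P.map (S j)).map _ = _
    rw [← (iIndepFun_iff_map_fun_eq_pi_map fun j => (hSm j).aemeasurable).1 hSindep,
      Measure.map_map hsum.measurable (by fun_prop)]
    rfl
  have hSsum : Measurable fun ω => ∑ j, S j ω := by fun_prop
  -- the sum has no atoms, because its summand from the treated unit `j₀` has none
  have hatom (k : Fin K) (b : ℝ) : (Qsum : Measure (Fin K → ℝ)) {x | x k = b} = 0 := by
    have hSk (j) : Measurable fun ω => S j ω k := measurable_pi_iff.1 (hSm j) k
    have hind : iIndepFun (fun j ω => S j ω k) P :=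
      hSindep.comp (fun _ z => z k) fun _ => measurable_pi_apply k
    have h₀ (b : ℝ) : P {ω | S j₀ ω k = b} = 0 := by
      have hrow : (H j₀ (Z (Sum.inl j₀)) (δ j₀)) k ≠ 0 := fun h =>
        (hdet j₀ _ (hinl j₀)).ne_zero
          (Matrix.det_eq_zero_of_row_eq_zero k fun l => congrFun h l)
      rw [← hModel.continuous j₀ _ b hrow]
      refine measure_congr ?_
      filter_upwards [hModel.factor j₀ _ (hinl j₀)] with ω hω
      exact congrArg (· = b) (congrFun hω k)
    have h := FewTreatedDID.measure_add_eq_zero_of_indepFun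
      (X := ∑ j ∈ Finset.univ.erase j₀, fun ω => S j ω k) (Y := fun ω => S j₀ ω k)
      (by fun_prop) (hSk j₀)
      (hind.indepFun_finsetSum_of_notMem hSk (Finset.notMem_erase j₀ _)) h₀ b
    rw [hQsum, Measure.map_apply hSsum
      (measurableSet_eq_fun (measurable_pi_apply k) measurable_const), ← h]
    congr 1
    ext ω
    simp [Finset.sum_apply]
  have hconv := ((ProbabilityMeasure.continuous_map hsum).comp
    ProbabilityMeasure.continuous_pi).continuousAt.tendsto.comp (tendsto_pi_nhds.2 hunit)
  rw [Metric.tendsto_nhds]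
  intro ε hε
  filter_upwards [hconv.eventually (FewTreatedDID.eventually_forall_abs_measureReal_Iic_sub_le
      Qsum hatom (half_pos hε)),
    (FewTreatedDID.tendsto_fst_inProb P).eventually (eventually_ne_atTop 0)] with x hx hx0
  rw [Real.dist_0_eq_abs, abs_of_nonneg (Real.iSup_nonneg fun _ => abs_nonneg _)]
  refine (Real.iSup_le (fun c => ?_) (half_pos hε).le).trans_lt (half_lt_self hε)
  have htarget : FewTreatedDID.targetCDF P A B η c =
      (Qsum : Measure (Fin K → ℝ)).real (Set.Iic c) := by
    rw [hQsum, measureReal_def, Measure.map_apply hSsum measurableSet_Iic]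
    rfl
  rw [FewTreatedDID.bootstrapCDF_eq_measureReal _ _ _ _ _ _ hx0, htarget]
  exact hx c
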